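/- Let $p,q\ge 0$ be integers with $n=p+q\ge 1$, and let $\mathcal{C}\ell(p,q)$ be the complex Clifford algebra: the unital associative $\mathbb{C}$-algebra generated by $e^1,\dots,e^n$ subject to $e^ae^b+e^be^a=2\eta^{ab}e$, where $e$ is the identity element and $\eta=\operatorname{diag}(1,\dots,1,-1,\dots,-1)$ with $p$ entries $+1$ and $q$ entries $-1$. A matrix representation of $\mathcal{C}\ell(p,q)$ is a faithful (injective) unital $\mathbb{C}$-algebra homomorphism $\gamma:\mathcal{C}\ell(p,q)\to \mathrm{Mat}(N,\mathbb{C})$; it is of minimal dimension if no faithful unital $\mathbb{C}$-algebra homomorphism $\mathcal{C}\ell(p,q)\to \mathrm{Mat}(M,\mathbb{C})$ with $M<N$ exists. Then the determinant $\operatorname{Det}U:=\det(\gamma(U))$, where $\gamma$ is any matrix representation of minimal dimension, is well defined, i.e. such representations exist and the value does not depend on the choice of $\gamma$: there is exactly one function $\operatorname{Det}:\mathcal{C}\ell(p,q)\to\mathbb{C}$ such that $\operatorname{Det}U=\det(\gamma(U))$ for every matrix representation $\gamma$ of minimal dimension and every $U\in\mathcal{C}\ell(p,q)$. -/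

import Mathlib

/-- The diagonal entries `η^{aa}` of the signature matrix: the first `p` of them are `+1`, the
remaining `q` are `-1`. -/
def signatureWeight (p q : ℕ) (a : Fin (p + q)) : ℂ :=
  if (a : ℕ) < p then 1 else -1

/-- The quadratic form `x ↦ x₁² + ⋯ + x_p² - x_{p+1}² - ⋯ - x_{p+q}²` on `ℂ^{p+q}`. -/
noncomputable def signatureForm (p q : ℕ) : QuadraticForm ℂ (Fin (p + q) → ℂ) :=
  QuadraticMap.weightedSumSquares ℂ (signatureWeight p q)

/-- The complex Clifford algebra `Cl(p,q)`. -/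
abbrev ComplexClifford (p q : ℕ) : Type :=
  CliffordAlgebra (signatureForm p q)

/-- `γ` is a matrix representation of `Cl(p,q)` of minimal dimension: `γ` identifies `Cl(p,q)` with
a unital algebra of complex `N × N` matrices (that is, it is faithful), and no such identification
is possible with matrices of a smaller order. -/
structure IsMinimalMatrixRep {p q N : ℕ}
    (γ : ComplexClifford p q →ₐ[ℂ] Matrix (Fin N) (Fin N) ℂ) : Prop where
  faithful : Function.Injective γ
  minimal : ∀ (M : ℕ) (δ : ComplexClifford p q →ₐ[ℂ] Matrix (Fin M) (Fin M) ℂ),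
    Function.Injective δ → N ≤ M

/-! Averaging a linear projection onto a left ideal over the generators makes it `A`-linear, as in
Maschke's theorem, so `Cl(p,q)` is semisimple. By Wedderburn–Artin over `ℂ` it is a finite product
of matrix algebras of orders `d i`. A faithful representation kills no factor, so it contains every
simple module, hence their direct sum, the block diagonal representation
(`exists_intertwiner_blockDiagonal'`). The minimal order is therefore `∑ d i`. At that order the
intertwiner is square and invertible, so the determinant is that of the block diagonal matrix. -/

section Semisimple

variable {K A ι : Type*} [Field K] [Ring A] [Algebra K A]

/-- A linear projection onto a left ideal can be averaged over finitely many anticommuting elements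
with invertible scalar squares, so that it commutes with multiplication by each of them. -/
theorem exists_projection_commute_of_anticommute (h2 : (2 : K) ≠ 0) (e : ι → A) (w : ι → K)
    (hw : ∀ i, w i ≠ 0) (hsq : ∀ i, e i * e i = algebraMap K A (w i))
    (hanti : ∀ i j, i ≠ j → e i * e j = -(e j * e i)) (W : Submodule A A) (s : Finset ι) :
    ∃ f : A →ₗ[K] A, (∀ x, f x ∈ W) ∧ (∀ x ∈ W, f x = x) ∧
      ∀ i ∈ s, ∀ x, f (e i * x) = e i * f x := by
  classical
  have hsq' : ∀ i x, e i * (e i * x) = w i • x := fun i x => by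
    rw [← mul_assoc, hsq, Algebra.smul_def]
  induction s using Finset.induction_on with
  | empty =>
    obtain ⟨g, hg⟩ := (W.restrictScalars K).exists_isCompl
    refine ⟨(W.restrictScalars K).subtype ∘ₗ Submodule.projectionOnto _ g hg,
      fun x => Subtype.property (p := fun y => y ∈ W.restrictScalars K) _, fun x hx => ?_, by simp⟩
    exact congrArg Subtype.val
      (Submodule.projectionOnto_apply_left hg (⟨x, hx⟩ : W.restrictScalars K))
  | insert i s his ih =>
    obtain ⟨f, hfW, hfid, hfc⟩ := ih
    -- The mean of `f` and its conjugate by `e i`, since `(e i)⁻¹ = (w i)⁻¹ • e i`.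
    refine ⟨(2 : K)⁻¹ • (f + (w i)⁻¹ •
      (LinearMap.mulLeft K (e i) ∘ₗ f ∘ₗ LinearMap.mulLeft K (e i))), fun x => ?_,
      fun x hx => ?_, fun j hj x => ?_⟩
    · have h1 : e i * f (e i * x) ∈ W := W.smul_mem (e i) (hfW _)
      exact (W.restrictScalars K).smul_mem _
        (add_mem (hfW x) ((W.restrictScalars K).smul_mem _ h1))
    · have h1 : f (e i * x) = e i * x := hfid _ (W.smul_mem (e i) hx)
      simp only [LinearMap.smul_apply, LinearMap.add_apply, LinearMap.comp_apply,
        LinearMap.mulLeft_apply, hfid x hx, h1, hsq', smul_smul, inv_mul_cancel₀ (hw i), one_smul]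
      rw [← two_smul K x, smul_smul, inv_mul_cancel₀ h2, one_smul]
    · simp only [LinearMap.smul_apply, LinearMap.add_apply, LinearMap.comp_apply,
        LinearMap.mulLeft_apply, mul_smul_comm, mul_add]
      congr 1
      -- For `j = i` the two summands are exchanged; for `j ≠ i` the two signs from anticommuting
      -- cancel.
      by_cases hij : j = i
      · subst hij
        simp only [hsq', map_smul, mul_smul_comm, smul_smul, inv_mul_cancel₀ (hw j), one_smul]
        exact add_comm _ _
      · have hjs : j ∈ s := (Finset.mem_insert.mp hj).resolve_left hij
        have hij' : ∀ x, e i * (e j * x) = -(e j * (e i * x)) := fun x => by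
          rw [← mul_assoc, hanti i j (Ne.symm hij), neg_mul, mul_assoc]
        rw [hfc j hjs, hij', map_neg, hfc j hjs, mul_neg, hij', neg_neg]

/-- An algebra generated by finitely many anticommuting elements with invertible scalar squares is
semisimple. -/
theorem isSemisimpleRing_of_anticommute [Finite ι] (h2 : (2 : K) ≠ 0) (e : ι → A) (w : ι → K)
    (hw : ∀ i, w i ≠ 0) (hsq : ∀ i, e i * e i = algebraMap K A (w i))
    (hanti : ∀ i j, i ≠ j → e i * e j = -(e j * e i))
    (hgen : Algebra.adjoin K (Set.range e) = ⊤) : IsSemisimpleRing A := by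
  have := Fintype.ofFinite ι
  refine (isSemisimpleModule_iff A A).mpr ⟨fun W => ?_⟩
  obtain ⟨f, hfW, hfid, hfc⟩ :=
    exists_projection_commute_of_anticommute h2 e w hw hsq hanti W Finset.univ
  have hf : ∀ a x, f (a * x) = a * f x := fun a => by
    have ha : a ∈ Algebra.adjoin K (Set.range e) := hgen ▸ Algebra.mem_top
    induction ha using Algebra.adjoin_induction with
    | mem a ha =>
      obtain ⟨i, rfl⟩ := ha
      exact hfc i (Finset.mem_univ i)
    | algebraMap r => intro x; rw [← Algebra.smul_def, map_smul, Algebra.smul_def]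
    | add a b _ _ ha hb => intro x; rw [add_mul, map_add, ha, hb, add_mul]
    | mul a b _ _ ha hb => intro x; rw [mul_assoc, ha, hb, mul_assoc]
  let g : A →ₗ[A] W :=
    { toFun := fun x => ⟨f x, hfW x⟩
      map_add' := fun x y => Subtype.ext (map_add f x y)
      map_smul' := fun a x => Subtype.ext (hf a x) }
  exact ⟨_, LinearMap.isCompl_of_proj (f := g) fun x => Subtype.ext (hfid x x.2)⟩

end Semisimple

section PiMatrix

open Matrix

variable {K κ : Type*} [Field K] [Fintype κ] [DecidableEq κ] {d : κ → ℕ}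

theorem blockDiagonal'_single_mulVec (i : κ) (j k : Fin (d i)) (c : (Σ i, Fin (d i)) → K) :
    blockDiagonal' (Pi.single (M := fun i => Matrix (Fin (d i)) (Fin (d i)) K) i
      (Matrix.single j k 1)) *ᵥ c = Pi.single ⟨i, j⟩ (c ⟨i, k⟩) := by
  ext ⟨a, b⟩
  simp only [mulVec, dotProduct, Fintype.sum_sigma, blockDiagonal'_apply]
  rw [Finset.sum_eq_single a (fun x _ hx => by simp [Ne.symm hx]) (by simp)]
  by_cases ha : a = i
  · subst ha
    by_cases hb : b = j
    · subst hb
      simp [Matrix.single_apply]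
    · simp [hb, Ne.symm hb]
  · simp [ha]

/-- A faithful representation of a product of matrix algebras contains the representation by block
diagonal matrices. -/
theorem exists_intertwiner_blockDiagonal' [∀ i, NeZero (d i)] {N : ℕ}
    (γ : (Π i, Matrix (Fin (d i)) (Fin (d i)) K) →ₐ[K] Matrix (Fin N) (Fin N) K)
    (hγ : Function.Injective γ) :
    ∃ P : Matrix (Fin N) (Σ i, Fin (d i)) K, Function.Injective P.mulVec ∧
      ∀ X, γ X * P = P * blockDiagonal' X := by
  let E : (i : κ) → Fin (d i) → Fin (d i) → Π i, Matrix (Fin (d i)) (Fin (d i)) K :=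
    fun i j k => Pi.single i (Matrix.single j k 1)
  -- Faithfulness is used only here; the index `0` exists because `d i ≠ 0`.
  have hv : ∀ i, ∃ v, γ (E i 0 0) *ᵥ v ≠ 0 := fun i => by
    by_contra! h
    have h0 : γ (E i 0 0) = 0 := Matrix.mulVec_injective (funext fun v => by simp [h v])
    have h1 := congrFun (congrFun (congrFun (hγ (h0.trans (map_zero γ).symm)) i) 0) 0
    simp [E] at h1
  choose v hv using hv
  let P : Matrix (Fin N) (Σ i, Fin (d i)) K :=
    Matrix.of fun a ik => (γ (E ik.1 ik.2 0) *ᵥ v ik.1) a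
  have hcol : ∀ i k, P.col ⟨i, k⟩ = γ (E i k 0) *ᵥ v i := fun i k => rfl
  -- For fixed `i`, the `E i k 0` span a left ideal on which `X` acts by its `i`-th block.
  have hmul : ∀ X i k, X * E i k 0 = ∑ l, X i l k • E i l 0 := fun X i k => by
    funext a
    by_cases ha : a = i
    · subst ha
      ext b c
      simp [E, Finset.sum_apply, Matrix.sum_apply, Matrix.mul_apply, Matrix.single_apply,
        ite_and]
    · simp [E, Finset.sum_apply, ha]
  have hint : ∀ X, γ X * P = P * blockDiagonal' X := fun X => by
    ext a ⟨i, k⟩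
    have h1 : (γ X * P) a ⟨i, k⟩ = (γ X *ᵥ P.col ⟨i, k⟩) a := rfl
    rw [h1, hcol, mulVec_mulVec, ← map_mul, hmul, map_sum, Matrix.mul_apply, Fintype.sum_sigma,
      Finset.sum_eq_single i (fun x _ hx => by simp [blockDiagonal'_apply_ne _ _ _ hx]) (by simp),
      Matrix.sum_mulVec, Finset.sum_apply]
    refine Finset.sum_congr rfl fun l _ => ?_
    rw [map_smul, Matrix.smul_mulVec, blockDiagonal'_apply_eq, Pi.smul_apply, smul_eq_mul, mul_comm]
    rfl
  refine ⟨P, ?_, hint⟩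
  refine (injective_iff_map_eq_zero P.mulVecLin).mpr fun c hc => ?_
  funext ⟨i, k⟩
  -- The kernel of `P` is stable under block diagonal matrices, so matrix units isolate one
  -- coordinate of `c`.
  have h1 : P *ᵥ (blockDiagonal' (E i 0 k) *ᵥ c) = 0 := by
    rw [mulVec_mulVec, ← hint, ← mulVec_mulVec]
    change _ *ᵥ (P.mulVecLin c) = 0
    rw [hc, mulVec_zero]
  rw [blockDiagonal'_single_mulVec] at h1
  have h2 : c ⟨i, k⟩ • (γ (E i 0 0) *ᵥ v i) = 0 := by
    rw [← hcol, ← h1]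
    ext a
    simp [Matrix.col, mul_comm]
  exact (smul_eq_zero.mp h2).resolve_right (hv i)

/-- A faithful matrix representation of a product of matrix algebras has order at least the sum of
the orders of the factors. -/
theorem card_sigma_le_of_injective [∀ i, NeZero (d i)] {N : ℕ}
    (γ : (Π i, Matrix (Fin (d i)) (Fin (d i)) K) →ₐ[K] Matrix (Fin N) (Fin N) K)
    (hγ : Function.Injective γ) : Fintype.card (Σ i, Fin (d i)) ≤ N := by
  obtain ⟨P, hP, -⟩ := exists_intertwiner_blockDiagonal' γ hγ
  simpa using LinearMap.finrank_le_finrank_of_injective (f := P.mulVecLin) hP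

/-- A faithful matrix representation of a product of matrix algebras whose order is the sum of the
orders of the factors has the same determinant as the representation by block diagonal matrices. -/
theorem det_eq_det_blockDiagonal' [∀ i, NeZero (d i)] {N : ℕ}
    (γ : (Π i, Matrix (Fin (d i)) (Fin (d i)) K) →ₐ[K] Matrix (Fin N) (Fin N) K)
    (hγ : Function.Injective γ) (hN : Fintype.card (Σ i, Fin (d i)) = N)
    (X : Π i, Matrix (Fin (d i)) (Fin (d i)) K) : (γ X).det = (blockDiagonal' X).det := by
  obtain ⟨P, hP, hint⟩ := exists_intertwiner_blockDiagonal' γ hγ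
  let σ : Fin N ≃ Σ i, Fin (d i) := (Fintype.equivFinOfCardEq hN).symm
  have hdet : (P.submatrix id σ).det ≠ 0 := by
    refine ((Matrix.isUnit_iff_isUnit_det _).mp (mulVec_injective_iff_isUnit.mp ?_)).ne_zero
    intro x y hxy
    have h : ∀ x, P.submatrix id σ *ᵥ x = P *ᵥ (x ∘ σ.symm) := fun x =>
      Matrix.submatrix_mulVec_equiv P x id σ
    rw [h, h] at hxy
    exact σ.symm.surjective.injective_comp_right (hP hxy)
  have h := congrArg (fun M => (M.submatrix id σ).det) (hint X)
  have h1 : (γ X * P).submatrix id σ = γ X * P.submatrix id σ := rfl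
  have h2 : (P * blockDiagonal' X).submatrix id σ =
      P.submatrix id σ * (blockDiagonal' X).submatrix σ σ :=
    (Matrix.submatrix_mul_equiv _ _ _ _ _).symm
  simp only [h1, h2, det_mul, det_submatrix_equiv_self] at h
  rw [mul_comm] at h
  exact mul_left_cancel₀ hdet h

/-- The representation of a product of matrix algebras by block diagonal matrices. -/
noncomputable def blockDiagonalRep (K : Type*) [Field K] (d : κ → ℕ) :
    (Π i, Matrix (Fin (d i)) (Fin (d i)) K) →ₐ[K]
      Matrix (Fin (Fintype.card (Σ i, Fin (d i)))) (Fin (Fintype.card (Σ i, Fin (d i)))) K :=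
  (Matrix.reindexAlgEquiv K K (Fintype.equivFin (Σ i, Fin (d i)))).toAlgHom.comp
    (AlgHom.ofLinearMap
      { toFun := blockDiagonal'
        map_add' := blockDiagonal'_add
        map_smul' := blockDiagonal'_smul }
      blockDiagonal'_one blockDiagonal'_mul)

theorem blockDiagonalRep_injective (K : Type*) [Field K] (d : κ → ℕ) :
    Function.Injective (blockDiagonalRep K d) :=
  (Matrix.reindexAlgEquiv K K _).injective.comp blockDiagonal'_injective

end PiMatrix

section Clifford

theorem signatureWeight_ne_zero (p q : ℕ) (a : Fin (p + q)) : signatureWeight p q a ≠ 0 := by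
  unfold signatureWeight
  split_ifs <;> norm_num

theorem signatureForm_single (p q : ℕ) (a : Fin (p + q)) :
    signatureForm p q (Pi.single a 1) = signatureWeight p q a := by
  simp [signatureForm, QuadraticMap.weightedSumSquares_apply, Pi.single_apply]

theorem signatureForm_isOrtho (p q : ℕ) {a b : Fin (p + q)} (hab : a ≠ b) :
    (signatureForm p q).IsOrtho (Pi.single a 1) (Pi.single b 1) := by
  simp only [QuadraticMap.IsOrtho, signatureForm, QuadraticMap.weightedSumSquares_apply,
    Pi.add_apply, smul_eq_mul, ← Finset.sum_add_distrib]
  refine Finset.sum_congr rfl fun i _ => ?_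
  by_cases hi : i = a
  · subst hi
    simp [hab]
  · simp [Pi.single_apply, hi]

/-- As a vector space, the Clifford algebra is the exterior algebra, whatever the form. -/
instance complexClifford_finite (p q : ℕ) : FiniteDimensional ℂ (ComplexClifford p q) :=
  Module.Finite.of_basis ((Pi.basisFun ℂ (Fin (p + q))).ExteriorAlgebra.map
    (CliffordAlgebra.equivExterior (signatureForm p q)).symm)

theorem adjoin_range_ι_single (p q : ℕ) :
    Algebra.adjoin ℂ (Set.range fun a : Fin (p + q) =>
      CliffordAlgebra.ι (signatureForm p q) (Pi.single a 1)) = ⊤ := by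
  rw [eq_top_iff, ← CliffordAlgebra.adjoin_range_ι, Algebra.adjoin_le_iff]
  rintro _ ⟨x, rfl⟩
  rw [pi_eq_sum_univ' x, map_sum]
  refine sum_mem fun a _ => ?_
  rw [map_smul]
  refine Subalgebra.smul_mem _ (Algebra.subset_adjoin (Set.mem_range.mpr ⟨a, ?_⟩)) _
  congr 1

instance complexClifford_isSemisimpleRing (p q : ℕ) : IsSemisimpleRing (ComplexClifford p q) :=
  isSemisimpleRing_of_anticommute (K := ℂ) two_ne_zero
    (fun a => CliffordAlgebra.ι (signatureForm p q) (Pi.single a 1)) (signatureWeight p q)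
    (signatureWeight_ne_zero p q)
    (fun a => by rw [CliffordAlgebra.ι_sq_scalar, signatureForm_single])
    (fun _ _ hab => CliffordAlgebra.ι_mul_ι_comm_of_isOrtho (signatureForm_isOrtho p q hab))
    (adjoin_range_ι_single p q)

end Clifford

theorem mainTheorem3 (p q : ℕ) (hn : 1 ≤ p + q) :
    ∃! Det : ComplexClifford p q → ℂ,
      ∀ (N : ℕ) (γ : ComplexClifford p q →ₐ[ℂ] Matrix (Fin N) (Fin N) ℂ),
        IsMinimalMatrixRep γ → ∀ U : ComplexClifford p q, Det U = (γ U).det := by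
  obtain ⟨n, d, hd, ⟨e⟩⟩ :=
    IsSemisimpleRing.exists_algEquiv_pi_matrix_of_isAlgClosed ℂ (ComplexClifford p q)
  have hinj : ∀ {N : ℕ} (γ : ComplexClifford p q →ₐ[ℂ] Matrix (Fin N) (Fin N) ℂ),
      Function.Injective γ → Function.Injective (γ.comp e.symm.toAlgHom) := fun γ hγ =>
    hγ.comp e.symm.injective
  have hrep : Function.Injective ((blockDiagonalRep ℂ d).comp e.toAlgHom) :=
    (blockDiagonalRep_injective ℂ d).comp e.injective
  refine ⟨fun U => (Matrix.blockDiagonal' (e U)).det, fun N γ hγ U => ?_, fun Det hDet => ?_⟩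
  · have hN := le_antisymm (card_sigma_le_of_injective _ (hinj γ hγ.faithful))
      (hγ.minimal _ _ hrep)
    have h := det_eq_det_blockDiagonal' _ (hinj γ hγ.faithful) hN (e U)
    refine h.symm.trans ?_
    simp
  -- Uniqueness requires that a minimal representation exist; the block diagonal one attains the
  -- bound.
  · have hmin : IsMinimalMatrixRep ((blockDiagonalRep ℂ d).comp e.toAlgHom) :=
      ⟨hrep, fun M δ hδ => card_sigma_le_of_injective _ (hinj δ hδ)⟩
    funext U
    rw [hDet _ _ hmin U]
    exact det_eq_det_blockDiagonal' _ (blockDiagonalRep_injective ℂ d) rfl (e U)
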